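/- \textbf{Setting.} Consider a Markov decision process with finite state space $\mathcal S$ and finite action space $\mathcal A$, $S=|\mathcal S|$, $A=|\mathcal A|$, nonempty sets $\mathcal A_s\subseteq\mathcal A$ of allowed actions, and transition probabilities $P(s'\mid s,a)$. A pair $(s,a)$ is valid if $a\in\mathcal A_s$. The reward of slot $t$ is $r_t=f(s_t,a_t,X_t)$ with $f$ known and measurable in its last argument. The variables $X_0,X_1,\dots$ are i.i.d., and $X_t$ is independent of the history $s_0,a_0,X_0,\dots,X_{t-1},s_t,a_t$; given that history, $s_{t+1}$ has law $P(\cdot\mid s_t,a_t)$. The initial state is arbitrary. A policy is a map $\beta:\mathcal S\to\mathcal A$ with $\beta(s)\in\mathcal A_s$. The process is ergodic: under every policy the chain of states is irreducible and aperiodic; let $\pi_\beta$ be its stationary distribution. Put $$\mu(s,a)=\mathbb E[f(s,a,X)],\quad \rho(\beta)=\sum_s\pi_\beta(s)\,\mu(s,\beta(s)),\quad \rho^*=\max_\beta\rho(\beta).$$ Assume that there are at least two policies, that the maximum is attained by exactly one policy $\beta^*$, and that $\mu(s,a)\ge 0$ for all valid pairs. Let $$\Delta_1=\rho^*-\max_{\beta\ne\beta^*}\rho(\beta),\quad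 \mu_{\max}=\max_{(s,a)}\mu(s,a),\quad \Delta_{\max}=\rho^*-\min_{(s,a)}\mu(s,a),\quad \gamma=\max_{s,s'}\|P_*(s',\cdot)-P_*(s,\cdot)\|_{TV},$$ where $(s,a)$ ranges over the valid pairs and $P_*$ is the transition matrix under $\beta^*$, and assume $\gamma<1$. Let $\mathcal X$ be a set with $X_t\in\mathcal X$ almost surely, let $B(s,a)\ge\sup_{x\in\mathcal X}f(s,a,x)-\inf_{x\in\mathcal X}f(s,a,x)$ be finite bounds for the valid pairs, and let $B_0=\max_{(s,a)}B(s,a)>0$. \textbf{Epoch-LPSM} has integer parameters $n_0\ge1$ and $\eta\ge2$. In slot $0$ it takes an arbitrary valid action. Before slot $n\ge1$ it knows the sample means $\theta_n(s,a)=\frac1n\sum_{i<n}f(s,a,X_i)$ for all valid pairs. In each slot $n\in\{1,\dots,n_0-1\}\cup\{n_0\eta^k:k\ge0\}$ it takes any solution $\pi$ (ties broken in an arbitrary non-anticipating way) of the linear program $$\max\sum_{s}\sum_{a\in\mathcal A_s}\pi(s,a)\theta_n(s,a)\quad\text{s.t.}\quad \pi\ge0,\ \ \sum_{s}\sum_{a\in\mathcal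 A_s}\pi(s,a)=1,\ \ \sum_{a\in\mathcal A_{s'}}\pi(s',a)=\sum_s\sum_{a\in\mathcal A_s}\pi(s,a)P(s'\mid s,a)\ \ \forall s',$$ and adopts a policy $\beta$ with $\beta(s)\in\arg\max_{a\in\mathcal A_s}\pi(s,a)$ for every $s$; it keeps this policy until the next such slot. \textbf{Theorem (Epoch-LPSM regret bound).} The series $$\sigma_{n_0,\eta}=\sum_{k=0}^\infty\eta^k e^{-\frac12(\Delta_1/B_0)^2n_0\eta^k}\qquad\text{and}\qquad\sum_{k=1}^\infty e^{-2\left(\frac{\Delta_1}{2B_0}\right)^2n_0\eta^{k-1}}$$ converge, and for every $T\ge0$ the expected regret $\mathfrak R(T)=T\rho^*-\mathbb E\big[\sum_{t=0}^{T-1}r_t\big]$ of Epoch-LPSM is at most $$\Big(1+(1+A)S\,\frac{1-e^{-\frac12(\Delta_1/B_0)^2n_0}}{e^{\frac12(\Delta_1/B_0)^2}-1}\Big)\Big(\frac{\mu_{\max}}{1-\gamma}+\Delta_{\max}\Big)+(\eta-1)(1+A)S\,n_0\,\sigma_{n_0,\eta}\,\Delta_{\max}+(1+A)S\Big(\sum_{k=1}^\infty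 e^{-2\left(\frac{\Delta_1}{2B_0}\right)^2n_0\eta^{k-1}}\Big)\frac{\mu_{\max}}{1-\gamma}.$$ -/

import Mathlib

open MeasureTheory ProbabilityTheory
open scoped BigOperators

noncomputable section

/-- A Markov decision process with finite state space `S` and finite action space `A`, whose reward
in state `s` under action `a` is `f s a X` for an internal random variable `X` with law `ν`.
`P s a s'` is the probability of moving from `s` to `s'` when the action `a` is taken. Only the
values of `P` and `f` at pairs `(s, a)` with `a ∈ allowed s` matter. -/
structure RewardMDP (S A Ξ : Type*) [Fintype S] [Fintype A] [MeasurableSpace Ξ] where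
  allowed : S → Finset A
  allowed_nonempty : ∀ s, (allowed s).Nonempty
  P : S → A → S → ℝ
  P_nonneg : ∀ s, ∀ a ∈ allowed s, ∀ s', 0 ≤ P s a s'
  P_sum : ∀ s, ∀ a ∈ allowed s, ∑ s', P s a s' = 1
  f : S → A → Ξ → ℝ
  f_measurable : ∀ s, ∀ a ∈ allowed s, Measurable (f s a)
  ν : Measure Ξ
  ν_prob : IsProbabilityMeasure ν

namespace RewardMDP

variable {S A Ξ : Type*} [Fintype S] [Fintype A] [MeasurableSpace Ξ] (M : RewardMDP S A Ξ)

/-- Deterministic stationary policies: `β s` is an allowed action of `s`. -/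
abbrev Policy : Type _ := (s : S) → {a : A // a ∈ M.allowed s}

/-- Valid state-action pairs. -/
abbrev Pair : Type _ := {p : S × A // p.2 ∈ M.allowed p.1}

/-- Transition matrix of the Markov chain of states under the policy `β`. -/
def transMatrix (β : M.Policy) : Matrix S S ℝ := Matrix.of fun s s' => M.P s (β s) s'

/-- Aperiodicity: for every state `s`, the greatest common divisor of
`{n ≥ 1 | (Q ^ n) s s > 0}` is `1`. -/
def IsAperiodic [DecidableEq S] (Q : Matrix S S ℝ) : Prop :=
  ∀ s, ∀ d : ℕ, (∀ n : ℕ, 1 ≤ n → 0 < (Q ^ n) s s → d ∣ n) → d = 1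

/-- Every deterministic stationary policy yields an irreducible and aperiodic chain. -/
def IsErgodic [DecidableEq S] : Prop :=
  ∀ β : M.Policy, (M.transMatrix β).IsIrreducible ∧ IsAperiodic (M.transMatrix β)

/-- `p` is a stationary probability distribution of the transition matrix `Q`. -/
def IsStationaryDist (Q : Matrix S S ℝ) (p : S → ℝ) : Prop :=
  (∀ s, 0 ≤ p s) ∧ ∑ s, p s = 1 ∧ ∀ s', ∑ s, p s * Q s s' = p s'

open Classical in
/-- The stationary distribution `π_β` of the policy `β` (it exists and is unique for an ergodic
process). -/
def stationaryDist (β : M.Policy) : S → ℝ :=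
  if h : ∃ p, IsStationaryDist (M.transMatrix β) p then h.choose else 0

/-- Mean reward `μ(s, a) = E_X[f(s, a, X)]`. -/
def meanReward (s : S) (a : A) : ℝ := ∫ x, M.f s a x ∂M.ν

/-- Average reward per slot of `β` for the reward matrix `R`. -/
def rho (β : M.Policy) (R : S → A → ℝ) : ℝ := ∑ s, M.stationaryDist β s * R s (β s)

/-- Optimal mean reward `ρ* = max_β ρ(β, μ)`. -/
def rhoStar : ℝ := ⨆ β : M.Policy, M.rho β M.meanReward

/-- `Δ₁ = ρ* - max_{β ≠ β*} ρ(β, μ)`. -/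
def delta1 (βstar : M.Policy) : ℝ :=
  M.rhoStar - ⨆ β : {β : M.Policy // β ≠ βstar}, M.rho β.1 M.meanReward

/-- `μ_max`, the maximum of the mean rewards over the valid pairs. -/
def muMax : ℝ := ⨆ p : M.Pair, M.meanReward p.1.1 p.1.2

/-- `Δ_max = ρ* - min μ(s, a)`, the minimum being over the valid pairs. -/
def deltaMax : ℝ := M.rhoStar - ⨅ p : M.Pair, M.meanReward p.1.1 p.1.2

/-- `B₀ = max B(s, a)`, the maximum being over the valid pairs. -/
def maxRange (B : S → A → ℝ) : ℝ := ⨆ p : M.Pair, B p.1.1 p.1.2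

/-- Total variation distance `max_E |p(E) - q(E)|` of two distributions on `S`. -/
def tvDist (p q : S → ℝ) : ℝ := ⨆ E : Finset S, |∑ s ∈ E, p s - ∑ s ∈ E, q s|

/-- `γ = max_{s, s'} ‖P_β(s', ·) - P_β(s, ·)‖_TV`. -/
def gammaTV (β : M.Policy) : ℝ :=
  ⨆ q : S × S, tvDist (M.transMatrix β q.2) (M.transMatrix β q.1)

/-- Feasible points of the linear program (only the entries at valid pairs play a role). -/
def LPFeasible (p : S → A → ℝ) : Prop :=
  (∀ s, ∀ a ∈ M.allowed s, 0 ≤ p s a) ∧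
  ∑ s, ∑ a ∈ M.allowed s, p s a = 1 ∧
  ∀ s', ∑ a ∈ M.allowed s', p s' a = ∑ s, ∑ a ∈ M.allowed s, p s a * M.P s a s'

/-- Objective of the linear program for the reward matrix `R`. -/
def LPValue (R p : S → A → ℝ) : ℝ := ∑ s, ∑ a ∈ M.allowed s, p s a * R s a

/-- `p` solves the linear program for the reward matrix `R`. -/
def IsLPSolution (R p : S → A → ℝ) : Prop :=
  M.LPFeasible p ∧ ∀ p', M.LPFeasible p' → M.LPValue R p' ≤ M.LPValue R p

/-- `β` can be read off from some solution `p` of the linear program for `R`, through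
`β(s) ∈ argmax_{a ∈ A_s} p(s, a)`. -/
def IsLPPolicy (R : S → A → ℝ) (β : M.Policy) : Prop :=
  ∃ p, M.IsLPSolution R p ∧ ∀ s, ∀ a ∈ M.allowed s, p s a ≤ p s (β s)

/-- The running estimates before slot `n`, when `x i` is the internal variable of slot `i`:
they start at `0`, and slot `n` replaces `θ(s, a)` by `(n θ(s, a) + f(s, a, x n)) / (n + 1)`. -/
def theta (x : ℕ → Ξ) : ℕ → S → A → ℝ
  | 0, _, _ => 0
  | n + 1, s, a => (n * theta x n s a + M.f s a (x n)) / (n + 1)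

/-- The process evolves as the decision process `M`, relative to a filtration `ℱ` for which
`ℱ n` contains the history `s_0, a_0, x_0, …, x_{n-1}, s_n, a_n`
(and possibly independent randomisation):
the variables `X n` are i.i.d. with law `ν`, with `X n` independent of `ℱ n`, and the conditional
law of the next state given `ℱ n` is `P(· | s_n, a_n)`. -/
structure IsTrajectory {Ω : Type*} [mΩ : MeasurableSpace Ω] (Pr : Measure Ω)
    (ℱ : Filtration ℕ mΩ) (X : ℕ → Ω → Ξ) (state : ℕ → Ω → S) (action : ℕ → Ω → A) : Prop where
  state_adapted : ∀ n s, MeasurableSet[ℱ n] (state n ⁻¹' {s})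
  action_adapted : ∀ n a, MeasurableSet[ℱ n] (action n ⁻¹' {a})
  action_allowed : ∀ n ω, action n ω ∈ M.allowed (state n ω)
  X_measurable : ∀ n, Measurable[ℱ (n + 1)] (X n)
  X_law : ∀ n, Pr.map (X n) = M.ν
  X_indep : ∀ n, Indep (MeasurableSpace.comap (X n) inferInstance) (ℱ n) Pr
  transition : ∀ n s',
    Pr⟦state (n + 1) ⁻¹' {s'} | ℱ n⟧ =ᵐ[Pr] fun ω => M.P (state n ω) (action n ω) s'

/-- The slots in which Epoch-LPSM solves the linear program: `1, …, n₀ - 1` (in slot `0` an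
arbitrary valid action is taken) and `n₀ η ^ k` for `k = 0, 1, 2, …`. -/
def IsSolveTime (n₀ η n : ℕ) : Prop := (1 ≤ n ∧ n < n₀) ∨ ∃ k : ℕ, n = n₀ * η ^ k

/-- The actions are chosen by Epoch-LPSM with parameters `n₀` and `η`; `policy n` is the policy in
force in slot `n ≥ 1`. It is computed from the current estimates at every solve time, with
arbitrary non-anticipating selection among the solutions, and kept at all other times. -/
structure FollowsEpochLPSM {Ω : Type*} [mΩ : MeasurableSpace Ω] (n₀ η : ℕ)
    (ℱ : Filtration ℕ mΩ) (X : ℕ → Ω → Ξ) (state : ℕ → Ω → S) (action : ℕ → Ω → A)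
    (policy : ℕ → Ω → M.Policy) : Prop where
  policy_adapted : ∀ n β, MeasurableSet[ℱ n] (policy n ⁻¹' {β})
  solve : ∀ n ω, IsSolveTime n₀ η n →
    M.IsLPPolicy (M.theta (fun i => X i ω) n) (policy n ω)
  keep : ∀ n ω, 1 ≤ n → ¬ IsSolveTime n₀ η (n + 1) → policy (n + 1) ω = policy n ω
  act : ∀ n ω, 1 ≤ n → action n ω = policy n ω (state n ω)

/-- Cumulative regret `T ρ* - E[∑_{t < T} r_t]`, with `r_t = f(s_t, a_t, X_t)`. -/
def regret {Ω : Type*} [MeasurableSpace Ω] (Pr : Measure Ω)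
    (X : ℕ → Ω → Ξ) (state : ℕ → Ω → S) (action : ℕ → Ω → A) (T : ℕ) : ℝ :=
  T * M.rhoStar - ∫ ω, ∑ t ∈ Finset.range T, M.f (state t ω) (action t ω) (X t ω) ∂Pr

end RewardMDP

end

/-! Call a slot good if it is not slot 0 and the policy in force is β*. A bad slot loses at most
Δ_max on average. In a good slot the Poisson equation h - P_* h = r - ρ*, with r(s) = μ(s, β*(s)),
turns the mean loss ρ* - r(s_t) into the expected increment of h(s_t). Over a run of good slots
these increments telescope, so a whole run costs at most the oscillation of h, which is at most
μ_max / (1 - γ) because P_* contracts oscillations by the factor γ (`exists_poisson`,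
`sum_increments_le`, `regret_le_of_good`). It remains to bound the expected numbers of bad slots and
of entries into good runs.

A policy read off from any solution of the linear program, extremal or not, is optimal for the
estimated rewards (`IsLPPolicy.rho_le`). Hence a wrong choice at a solve time n forces some estimate
to be off by Δ₁ / 2. Hoeffding's inequality and a union bound over at most (1 + A) S events give
probability at most (1 + A) S exp(-c n) with c = (Δ₁ / B₀)² / 2 (`measureReal_policy_ne_le`).

From slot n₀ on, the policy is constant on each block [n₀ η^k, n₀ η^(k+1)). A wrong choice there
spoils (η - 1) n₀ η^k slots but leads to at most one entry, which explains the two different series.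
The slots before n₀ contribute the same bound to both counts: 1 for slot 0 plus a geometric sum. -/

namespace RewardMDP

/-! ### Finite Markov chains: stationarity, total variation, Poisson equation. -/

/-- Every stochastic matrix has a stationary distribution. -/
theorem exists_isStationaryDist {S : Type*} [Fintype S] [Nonempty S] (Q : Matrix S S ℝ)
    (hQ : ∀ i j, 0 ≤ Q i j) (hQ1 : ∀ i, ∑ j, Q i j = 1) : ∃ p, IsStationaryDist Q p := by
  classical
  -- The constant vector is a right null vector of `Q - 1`, so a nonzero left null vector `v`
  -- exists; its normalised absolute value will be stationary.
  have hdet : (Q - 1).det = 0 := by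
    rw [← Matrix.exists_mulVec_eq_zero_iff]
    refine ⟨1, one_ne_zero, ?_⟩
    ext i
    rw [Matrix.sub_mulVec, Matrix.one_mulVec]
    simp [Matrix.mulVec, dotProduct, hQ1]
  obtain ⟨v, hv0, hv⟩ := Matrix.exists_vecMul_eq_zero_iff.mpr hdet
  have hvQ : ∀ j, ∑ i, v i * Q i j = v j := by
    intro j
    have := congrFun hv j
    rw [Matrix.vecMul_sub, Matrix.vecMul_one] at this
    exact sub_eq_zero.mp this
  -- Since the rows sum to 1, both sides of this inequality have the same total over `j`, which
  -- forces equality everywhere.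
  have hle : ∀ j ∈ Finset.univ, |v j| ≤ ∑ i, |v i| * Q i j := by
    intro j _
    calc |v j| = |∑ i, v i * Q i j| := by rw [hvQ]
      _ ≤ ∑ i, |v i * Q i j| := Finset.abs_sum_le_sum_abs _ _
      _ = ∑ i, |v i| * Q i j := by simp [abs_mul, abs_of_nonneg (hQ _ _)]
  have hsum : ∑ j, |v j| = ∑ j, ∑ i, |v i| * Q i j := by
    rw [Finset.sum_comm]
    simp [← Finset.mul_sum, hQ1]
  have heq : ∀ j, |v j| = ∑ i, |v i| * Q i j := fun j =>
    (Finset.sum_eq_sum_iff_of_le hle).mp hsum j (Finset.mem_univ j)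
  have hpos : 0 < ∑ j, |v j| := by
    obtain ⟨i, hi⟩ := Function.ne_iff.mp hv0
    exact Finset.sum_pos' (fun _ _ => abs_nonneg _) ⟨i, Finset.mem_univ _, abs_pos.mpr hi⟩
  refine ⟨fun s => |v s| / ∑ j, |v j|, fun s => by positivity, ?_, fun s' => ?_⟩
  · rw [← Finset.sum_div, div_self hpos.ne']
  · beta_reduce
    rw [heq s', Finset.sum_div]
    exact Finset.sum_congr rfl fun _ _ => by ring

/-- A set of states that is nonempty and closed under the transitions of an irreducible matrix is
everything. -/
theorem forall_of_isIrreducible {S : Type*} [Fintype S] [DecidableEq S] {Q : Matrix S S ℝ}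
    (hQ : Q.IsIrreducible) {C : S → Prop} {s₀ : S} (h₀ : C s₀)
    (hC : ∀ s s', C s → 0 < Q s s' → C s') (s : S) : C s := by
  have key : ∀ k s, 0 < (Q ^ k) s₀ s → C s := by
    intro k
    induction k with
    | zero =>
      intro s hs
      by_cases h : s₀ = s
      · exact h ▸ h₀
      · simp [h] at hs
    | succ k ih =>
      intro s hs
      rw [pow_succ, Matrix.mul_apply] at hs
      obtain ⟨i, _, hi⟩ := Finset.exists_lt_of_sum_lt (s := Finset.univ)
        (f := fun _ => (0 : ℝ)) (by simpa using hs)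
      have hk := Matrix.pow_apply_nonneg hQ.nonneg k s₀ i
      have h1 : 0 < (Q ^ k) s₀ i := lt_of_le_of_ne hk fun h => by simp [← h] at hi
      exact hC i s (ih i h1) (pos_of_mul_pos_right hi hk)
  obtain ⟨k, _, hk⟩ := (Matrix.isIrreducible_iff_exists_pow_pos hQ.nonneg).mp hQ s₀ s
  exact key k s hk

/-- The difference of the means of a function under two distributions is at most its oscillation
times the total variation distance. -/
theorem sum_sub_le_tvDist {S : Type*} [Fintype S] (p q h : S → ℝ) (hp : ∑ s, p s = 1)
    (hq : ∑ s, q s = 1) {m D : ℝ} (hm : ∀ s, m ≤ h s) (hD : ∀ s, h s ≤ m + D) (hD0 : 0 ≤ D) :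
    ∑ s, p s * h s - ∑ s, q s * h s ≤ tvDist p q * D := by
  classical
  -- Centring `h` at `m` is free because `p` and `q` have equal mass; then only the states in `E`
  -- contribute positively, each with weight at most `D`.
  set E : Finset S := Finset.univ.filter fun s => q s ≤ p s
  have h1 : ∑ s, p s * h s - ∑ s, q s * h s = ∑ s, (p s - q s) * (h s - m) := by
    simp only [sub_mul, mul_sub, Finset.sum_sub_distrib, ← Finset.sum_mul, hp, hq]
    ring
  have h2 : ∑ s, (p s - q s) * (h s - m) ≤ ∑ s ∈ E, (p s - q s) * D := by
    rw [Finset.sum_filter]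
    refine Finset.sum_le_sum fun s _ => ?_
    split_ifs with hs
    · exact mul_le_mul_of_nonneg_left (by linarith [hD s]) (by linarith)
    · exact mul_nonpos_of_nonpos_of_nonneg (by linarith) (by linarith [hm s])
  have h3 : ∑ s ∈ E, p s - ∑ s ∈ E, q s ≤ tvDist p q :=
    (le_abs_self _).trans
      (le_ciSup (f := fun E : Finset S => |∑ s ∈ E, p s - ∑ s ∈ E, q s|)
        (Set.finite_range _).bddAbove E)
  rw [← Finset.sum_mul, Finset.sum_sub_distrib] at h2
  exact h1.le.trans (h2.trans (mul_le_mul_of_nonneg_right h3 hD0))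

/-- Poisson equation for a stochastic matrix whose rows are at total variation distance at most
`γ < 1`, with a solution of oscillation at most that of the reward divided by `1 - γ`. -/
theorem exists_poisson {S : Type*} [Fintype S] [Nonempty S] {Q : Matrix S S ℝ} {p : S → ℝ}
    (hQ1 : ∀ s, ∑ s', Q s s' = 1) (hp : IsStationaryDist Q p) {γ : ℝ} (hγ : γ < 1)
    (hTV : ∀ s s', tvDist (Q s) (Q s') ≤ γ) {r : S → ℝ} {D : ℝ} (hr0 : ∀ s, 0 ≤ r s)
    (hrD : ∀ s, r s ≤ D) :
    ∃ h : S → ℝ, (∀ s, 0 ≤ h s) ∧ (∀ s, h s ≤ D / (1 - γ)) ∧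
      ∀ s, h s - ∑ s', Q s s' * h s' = r s - ∑ s', p s' * r s' := by
  -- Comparing a maximiser and a minimiser of `h`: averaging by `Q` shrinks the oscillation to at
  -- most `γ` times itself, so `h - Q h` keeps at least the fraction `1 - γ` of it.
  have span : ∀ (h : S → ℝ) (D' : ℝ),
      (∀ s s', (h s - ∑ t, Q s t * h t) - (h s' - ∑ t, Q s' t * h t) ≤ D') →
      ∀ s s', (h s - h s') * (1 - γ) ≤ D' := by
    intro h D' hD' s s'
    obtain ⟨i, hi⟩ := Finite.exists_max h
    obtain ⟨j, hj⟩ := Finite.exists_min h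
    have h1 := sum_sub_le_tvDist (Q i) (Q j) h (hQ1 i) (hQ1 j) (m := h j) (D := h i - h j) hj
      (fun s => by linarith [hi s]) (by linarith [hi j])
    have h2 := mul_le_mul_of_nonneg_right (hTV i j) (show 0 ≤ h i - h j by linarith [hi j])
    have h3 := hD' i j
    calc (h s - h s') * (1 - γ) ≤ (h i - h j) * (1 - γ) :=
          mul_le_mul_of_nonneg_right (by linarith [hi s, hj s']) (by linarith)
      _ ≤ D' := by linarith
  -- Adding the `p`-mean to `h - Q h` removes the constants from the kernel. The map is then
  -- injective by `span` with `D' = 0`, hence surjective in finite dimension.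
  let L : (S → ℝ) →ₗ[ℝ] (S → ℝ) :=
    { toFun := fun h s => h s - ∑ t, Q s t * h t + ∑ t, p t * h t
      map_add' := fun x y => by
        ext s
        simp only [Pi.add_apply, mul_add, Finset.sum_add_distrib]
        ring
      map_smul' := fun c x => by
        ext s
        simp only [Pi.smul_apply, smul_eq_mul, RingHom.id_apply, mul_left_comm _ c,
          ← Finset.mul_sum]
        ring }
  have hLa : ∀ h s, L h s = h s - ∑ t, Q s t * h t + ∑ t, p t * h t := fun _ _ => rfl
  have hmean : ∀ h, ∑ s, p s * L h s = ∑ t, p t * h t := by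
    intro h
    have hstat : ∑ s, p s * ∑ t, Q s t * h t = ∑ t, p t * h t := by
      simp only [Finset.mul_sum]
      rw [Finset.sum_comm]
      refine Finset.sum_congr rfl fun t _ => ?_
      rw [← hp.2.2 t, Finset.sum_mul]
      exact Finset.sum_congr rfl fun _ _ => by ring
    simp only [hLa, mul_add, mul_sub, Finset.sum_add_distrib, Finset.sum_sub_distrib, hstat,
      ← Finset.sum_mul, hp.2.1]
    ring
  have hinj : Function.Injective L := by
    rw [← LinearMap.ker_eq_bot, LinearMap.ker_eq_bot']
    intro h hh
    have h0 : ∑ t, p t * h t = 0 := by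
      rw [← hmean, hh]
      simp
    have h1 : ∀ s, h s - ∑ t, Q s t * h t = 0 := fun s => by
      have := congrFun hh s
      rw [hLa, h0] at this
      simpa using this
    have h2 : ∀ s s', h s ≤ h s' := fun s s' => by
      have := span h 0 (fun s s' => by rw [h1, h1]; simp) s s'
      nlinarith
    ext s
    have h3 : ∀ t, h t = h s := fun t => le_antisymm (h2 t s) (h2 s t)
    simpa [h3, ← Finset.sum_mul, hp.2.1] using h0
  obtain ⟨h, hh⟩ := (LinearMap.injective_iff_surjective.mp hinj) r
  have hpois : ∀ s, h s - ∑ t, Q s t * h t = r s - ∑ t, p t * r t := by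
    intro s
    have h1 := hmean h
    rw [hh] at h1
    have h2 := congrFun hh s
    rw [hLa] at h2
    linarith
  obtain ⟨j, hj⟩ := Finite.exists_min h
  refine ⟨fun s => h s - h j, fun s => by linarith [hj s], fun s => ?_, fun s => ?_⟩
  · rw [le_div_iff₀ (by linarith)]
    exact span h D (fun s s' => by rw [hpois, hpois]; linarith [hr0 s', hrD s]) s j
  · simp only [mul_sub, Finset.sum_sub_distrib, ← Finset.sum_mul, hQ1]
    linarith [hpois s]

/-! ### The linear program and its policies. -/

variable {S A Ξ : Type*} [Fintype S] [Fintype A] [MeasurableSpace Ξ] (M : RewardMDP S A Ξ)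

theorem isStationaryDist_stationaryDist [Nonempty S] (β : M.Policy) :
    IsStationaryDist (M.transMatrix β) (M.stationaryDist β) := by
  have h : ∃ p, IsStationaryDist (M.transMatrix β) p :=
    exists_isStationaryDist _ (fun s s' => M.P_nonneg s _ (β s).2 s')
      (fun s => M.P_sum s _ (β s).2)
  rw [stationaryDist, dif_pos h]
  exact h.choose_spec

open Classical in
/-- The occupation measure of a policy. -/
noncomputable def occupation (β : M.Policy) (s : S) (a : A) : ℝ :=
  if a = β s then M.stationaryDist β s else 0

theorem sum_occupation_mul (β : M.Policy) (s : S) (g : A → ℝ) :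
    ∑ a ∈ M.allowed s, M.occupation β s a * g a = M.stationaryDist β s * g (β s) := by
  rw [Finset.sum_eq_single_of_mem _ (β s).2 fun a _ ha => by simp [occupation, ha]]
  simp [occupation]

theorem lpValue_occupation (β : M.Policy) (R : S → A → ℝ) :
    M.LPValue R (M.occupation β) = M.rho β R := by
  simp only [LPValue, rho, sum_occupation_mul]

theorem sum_occupation (β : M.Policy) (s : S) :
    ∑ a ∈ M.allowed s, M.occupation β s a = M.stationaryDist β s := by
  simpa using M.sum_occupation_mul β s fun _ => 1

theorem lpFeasible_occupation [Nonempty S] (β : M.Policy) : M.LPFeasible (M.occupation β) := by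
  obtain ⟨h0, h1, h2⟩ := M.isStationaryDist_stationaryDist β
  refine ⟨fun s a _ => ?_, ?_, fun s' => ?_⟩
  · unfold occupation
    split_ifs
    exacts [h0 s, le_rfl]
  · simp only [sum_occupation, h1]
  · simp only [sum_occupation_mul, sum_occupation]
    exact (h2 s').symm

/-- At a state of positive mass, the argmax action has positive mass. Flow balance passes this mass
on along the transitions of `β`, and irreducibility carries it to every state. -/
theorem IsLPPolicy.pos [Nonempty S] [DecidableEq S] {M : RewardMDP S A Ξ} {β : M.Policy}
    (hirr : (M.transMatrix β).IsIrreducible) {p : S → A → ℝ} (hp : M.LPFeasible p)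
    (hβ : ∀ s, ∀ a ∈ M.allowed s, p s a ≤ p s (β s)) (s : S) : 0 < p s (β s) := by
  obtain ⟨h0, h1, h2⟩ := hp
  have hpos : ∀ s, 0 < ∑ a ∈ M.allowed s, p s a → 0 < p s (β s) := by
    intro s hs
    obtain ⟨a, ha, hpa⟩ := Finset.exists_lt_of_sum_lt (s := M.allowed s)
        (f := fun _ => (0 : ℝ)) (by simpa using hs)
    exact hpa.trans_le (hβ s a ha)
  obtain ⟨s₀, _, hs₀⟩ := Finset.exists_lt_of_sum_lt (s := Finset.univ)
    (f := fun _ => (0 : ℝ)) (g := fun s => ∑ a ∈ M.allowed s, p s a) (by simp [h1])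
  refine forall_of_isIrreducible hirr (C := fun s => 0 < p s (β s)) (hpos s₀ hs₀) ?_ s
  intro s s' hs hss'
  refine hpos s' ?_
  rw [h2 s']
  have hnn : ∀ s, ∀ a ∈ M.allowed s, 0 ≤ p s a * M.P s a s' := fun s a ha =>
    mul_nonneg (h0 s a ha) (M.P_nonneg s a ha s')
  exact Finset.sum_pos' (fun s _ => Finset.sum_nonneg (hnn s))
    ⟨s, Finset.mem_univ s, Finset.sum_pos' (hnn s) ⟨β s, (β s).2, mul_pos hs hss'⟩⟩

/-- A policy read off from a solution of the linear program is optimal for its rewards. -/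
theorem IsLPPolicy.rho_le [Nonempty S] [DecidableEq S] {M : RewardMDP S A Ξ}
    (hM : M.IsErgodic) {R : S → A → ℝ} {β : M.Policy} (h : M.IsLPPolicy R β)
    (β' : M.Policy) : M.rho β' R ≤ M.rho β R := by
  classical
  obtain ⟨p, ⟨hp, hmax⟩, hβ⟩ := h
  have hppos := IsLPPolicy.pos (hM β).1 hp hβ
  set q := M.occupation β with hq
  have hqf : M.LPFeasible q := M.lpFeasible_occupation β
  -- The least mass that `p` puts on `β` serves as `ε`, since stationary probabilities are at most
  -- 1.
  obtain ⟨ε, hε, hεp⟩ : ∃ ε : ℝ, 0 < ε ∧ ∀ s, ε * M.stationaryDist β s ≤ p s (β s) := by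
    obtain ⟨j, hj⟩ := Finite.exists_min fun s => p s (β s)
    have hstat := M.isStationaryDist_stationaryDist β
    refine ⟨p j (β j), hppos j, fun s => ?_⟩
    have h1 : M.stationaryDist β s ≤ 1 := by
      rw [← hstat.2.1]
      exact Finset.single_le_sum (fun s _ => hstat.1 s) (Finset.mem_univ s)
    nlinarith [hj s, hppos j]
  -- Extrapolation from `q` through and slightly beyond `p`. It stays feasible by the choice of `ε`,
  -- so if `q` were worse than `p`, then `w` would beat the optimum.
  let w : S → A → ℝ := fun s a => (1 + ε) * p s a - ε * q s a
  have hlin : ∀ g : S → A → ℝ, ∑ s, ∑ a ∈ M.allowed s, w s a * g s a =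
      (1 + ε) * (∑ s, ∑ a ∈ M.allowed s, p s a * g s a)
        - ε * (∑ s, ∑ a ∈ M.allowed s, q s a * g s a) := by
    intro g
    simp only [w, sub_mul, Finset.sum_sub_distrib, Finset.mul_sum, mul_assoc]
  have hwf : M.LPFeasible w := by
    refine ⟨fun s a ha => ?_, ?_, fun s' => ?_⟩
    · simp only [w, hq, occupation]
      have := hp.1 s a ha
      split_ifs with hs
      · subst hs
        nlinarith [hεp s]
      · nlinarith
    · have := hlin fun _ _ => 1
      simp only [mul_one] at this
      rw [this, hp.2.1, hqf.2.1]
      ring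
    · rw [hlin fun s a => M.P s a s', ← hp.2.2, ← hqf.2.2]
      simp only [w, Finset.sum_sub_distrib, Finset.mul_sum]
  have hw := hmax w hwf
  have hval : M.LPValue R w = (1 + ε) * M.LPValue R p - ε * M.LPValue R q := hlin R
  have hpq : M.LPValue R p ≤ M.LPValue R q := by
    rw [hval] at hw
    exact le_of_mul_le_mul_left (by linarith) hε
  calc M.rho β' R = M.LPValue R (M.occupation β') := (M.lpValue_occupation β' R).symm
    _ ≤ M.LPValue R p := hmax _ (M.lpFeasible_occupation β')
    _ ≤ M.rho β R := hpq.trans (M.lpValue_occupation β R).le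

/-- An average under a probability vector preserves strict inequality, as some state has positive
mass. Strictness lets the deviation events be closed ones, as in Hoeffding's inequality. -/
theorem rho_le_rho_add [Nonempty S] (β : M.Policy) {R R' : S → A → ℝ} {δ : ℝ}
    (h : ∀ s, R s (β s) < R' s (β s) + δ) : M.rho β R < M.rho β R' + δ := by
  obtain ⟨h0, h1, _⟩ := M.isStationaryDist_stationaryDist β
  have : M.rho β R' + δ = ∑ s, M.stationaryDist β s * (R' s (β s) + δ) := by
    simp only [rho, mul_add, Finset.sum_add_distrib, ← Finset.sum_mul, h1, one_mul]
  rw [this]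
  obtain ⟨s₀, _, hs₀⟩ := Finset.exists_lt_of_sum_lt (s := Finset.univ)
    (f := fun _ => (0 : ℝ)) (g := M.stationaryDist β) (by simp [h1])
  exact Finset.sum_lt_sum (fun s _ => mul_le_mul_of_nonneg_left (h s).le (h0 s))
    ⟨s₀, Finset.mem_univ _, mul_lt_mul_of_pos_left (h s₀) hs₀⟩

end RewardMDP

/-! ### Gaps, concentration of the estimates, and the probability of a wrong policy. -/

namespace RewardMDP

variable {S A Ξ : Type*} [Fintype S] [Fintype A] [MeasurableSpace Ξ] {M : RewardMDP S A Ξ}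

theorem nat_mul_theta (x : ℕ → Ξ) (n : ℕ) (s : S) (a : A) :
    n * M.theta x n s a = ∑ i ∈ Finset.range n, M.f s a (x i) := by
  induction n with
  | zero => simp
  | succ n ih =>
    rw [Finset.sum_range_succ, ← ih, theta, Nat.cast_succ, mul_div_cancel₀]
    positivity

theorem rho_le_rhoStar (β : M.Policy) : M.rho β M.meanReward ≤ M.rhoStar := by
  classical
  exact le_ciSup (f := fun β => M.rho β M.meanReward) (Set.finite_range _).bddAbove β

theorem rhoStar_eq {βstar : M.Policy}
    (hopt : ∀ β : M.Policy, β ≠ βstar → M.rho β M.meanReward < M.rho βstar M.meanReward) :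
    M.rhoStar = M.rho βstar M.meanReward := by
  have : Nonempty M.Policy := ⟨βstar⟩
  refine le_antisymm (ciSup_le fun β => ?_) (rho_le_rhoStar βstar)
  by_cases h : β = βstar
  · rw [h]
  · exact (hopt β h).le

theorem delta1_le {βstar β : M.Policy} (h : β ≠ βstar) :
    M.delta1 βstar ≤ M.rhoStar - M.rho β M.meanReward := by
  classical
  have := le_ciSup (f := fun β : {β : M.Policy // β ≠ βstar} => M.rho β.1 M.meanReward)
    (Set.finite_range _).bddAbove ⟨β, h⟩
  unfold delta1
  linarith

theorem delta1_pos {βstar : M.Policy}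
    (hopt : ∀ β : M.Policy, β ≠ βstar → M.rho β M.meanReward < M.rho βstar M.meanReward)
    (hne : ∃ β : M.Policy, β ≠ βstar) : 0 < M.delta1 βstar := by
  classical
  have : Nonempty {β : M.Policy // β ≠ βstar} := nonempty_subtype.mpr hne
  obtain ⟨β, hβ⟩ := exists_eq_ciSup_of_finite
    (f := fun β : {β : M.Policy // β ≠ βstar} => M.rho β.1 M.meanReward)
  rw [delta1, ← hβ, rhoStar_eq hopt]
  linarith [hopt β.1 β.2]

theorem meanReward_le_muMax {s : S} {a : A} (h : a ∈ M.allowed s) :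
    M.meanReward s a ≤ M.muMax :=
  le_ciSup (f := fun p : M.Pair => M.meanReward p.1.1 p.1.2) (Set.finite_range _).bddAbove
    ⟨(s, a), h⟩

theorem rhoStar_sub_le_deltaMax {s : S} {a : A} (h : a ∈ M.allowed s) :
    M.rhoStar - M.meanReward s a ≤ M.deltaMax := by
  have := ciInf_le (f := fun p : M.Pair => M.meanReward p.1.1 p.1.2)
    (Set.finite_range _).bddBelow ⟨(s, a), h⟩
  unfold deltaMax
  linarith

theorem le_maxRange (B : S → A → ℝ) {s : S} {a : A} (h : a ∈ M.allowed s) :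
    B s a ≤ M.maxRange B :=
  le_ciSup (f := fun p : M.Pair => B p.1.1 p.1.2) (Set.finite_range _).bddAbove ⟨(s, a), h⟩

theorem tvDist_le_gammaTV (β : M.Policy) (s s' : S) :
    tvDist (M.transMatrix β s) (M.transMatrix β s') ≤ M.gammaTV β :=
  le_ciSup (f := fun q : S × S => tvDist (M.transMatrix β q.2) (M.transMatrix β q.1))
    (Set.finite_range _).bddAbove (s', s)

theorem deltaMax_nonneg [Nonempty S] (β : M.Policy) : 0 ≤ M.deltaMax := by
  obtain ⟨h0, h1, _⟩ := M.isStationaryDist_stationaryDist β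
  have hle : M.rho β M.meanReward ≥ ⨅ p : M.Pair, M.meanReward p.1.1 p.1.2 := by
    calc M.rho β M.meanReward
        ≥ ∑ s, M.stationaryDist β s * ⨅ p : M.Pair, M.meanReward p.1.1 p.1.2 :=
          Finset.sum_le_sum fun s _ => mul_le_mul_of_nonneg_left
            (ciInf_le (f := fun p : M.Pair => M.meanReward p.1.1 p.1.2)
              (Set.finite_range _).bddBelow ⟨(s, β s), (β s).2⟩) (h0 s)
      _ = _ := by rw [← Finset.sum_mul, h1, one_mul]
  have := rho_le_rhoStar β
  unfold deltaMax
  linarith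

/-- A function whose values on a nonempty set differ by at most `B` takes its values on that set
in an interval of length `B`. -/
theorem exists_forall_mem_Icc {α : Type*} {g : α → ℝ} {s : Set α} {B : ℝ}
    (h : ∀ x ∈ s, ∀ y ∈ s, g x - g y ≤ B) : ∃ a, ∀ x ∈ s, g x ∈ Set.Icc a (a + B) := by
  rcases s.eq_empty_or_nonempty with rfl | ⟨x₀, hx₀⟩
  · exact ⟨0, by simp⟩
  · have hbdd : BddBelow (g '' s) := ⟨g x₀ - B, by
      rintro _ ⟨y, hy, rfl⟩
      linarith [h x₀ hx₀ y hy]⟩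
    refine ⟨sInf (g '' s), fun x hx => ⟨csInf_le hbdd ⟨x, hx, rfl⟩, ?_⟩⟩
    have : g x - B ≤ sInf (g '' s) := le_csInf ⟨_, x₀, hx₀, rfl⟩ (by
      rintro _ ⟨y, hy, rfl⟩
      linarith [h x hx y hy])
    linarith

/-- On the support of the internal variable, the rewards of a valid pair lie in an interval of
length `maxRange B`. -/
theorem exists_ae_mem_Icc {supp : Set Ξ} (hsupp : ∀ᵐ x ∂M.ν, x ∈ supp) {B : S → A → ℝ}
    (hB : ∀ s, ∀ a ∈ M.allowed s, ∀ x ∈ supp, ∀ y ∈ supp, M.f s a x - M.f s a y ≤ B s a)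
    {s : S} {a : A} (h : a ∈ M.allowed s) :
    ∃ l, ∀ᵐ x ∂M.ν, M.f s a x ∈ Set.Icc l (l + M.maxRange B) := by
  obtain ⟨l, hl⟩ := exists_forall_mem_Icc (g := M.f s a) (s := supp) (B := M.maxRange B)
    fun x hx y hy => (hB s a h x hx y hy).trans (le_maxRange B h)
  exact ⟨l, hsupp.mono hl⟩

variable {Ω : Type*} [mΩ : MeasurableSpace Ω] {Pr : Measure Ω}
  {ℱ : Filtration ℕ mΩ} {X : ℕ → Ω → Ξ} {state : ℕ → Ω → S} {action : ℕ → Ω → A}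

namespace IsTrajectory

theorem measurable_X (ht : M.IsTrajectory Pr ℱ X state action) (n : ℕ) : Measurable (X n) :=
  (ht.X_measurable n).mono (ℱ.le _) le_rfl

theorem ae_X (ht : M.IsTrajectory Pr ℱ X state action) {q : Ξ → Prop} (h : ∀ᵐ x ∂M.ν, q x)
    (n : ℕ) : ∀ᵐ ω ∂Pr, q (X n ω) := by
  rw [← ht.X_law n] at h
  exact ae_of_ae_map (ht.measurable_X n).aemeasurable h

theorem integral_comp_X (ht : M.IsTrajectory Pr ℱ X state action) {g : Ξ → ℝ}
    (hg : Measurable g) (n : ℕ) : ∫ ω, g (X n ω) ∂Pr = ∫ x, g x ∂M.ν := by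
  rw [← ht.X_law n, integral_map (ht.measurable_X n).aemeasurable hg.aestronglyMeasurable]

theorem measurable_sum (ht : M.IsTrajectory Pr ℱ X state action) {g : Ξ → ℝ}
    (hg : Measurable g) (n : ℕ) :
    Measurable[ℱ n] fun ω => ∑ i ∈ Finset.range n, g (X i ω) :=
  Finset.measurable_fun_sum _ fun i hi =>
    (hg.comp (ht.X_measurable i)).mono (ℱ.mono (Finset.mem_range.mp hi)) le_rfl

variable [IsProbabilityMeasure Pr]

/-- The sum over earlier slots is measurable for `ℱ n`, of which `X n` is independent, so the
sub-Gaussian parameters (D / 2)² of Hoeffding's lemma add up. -/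
theorem hasSubgaussianMGF_sum (ht : M.IsTrajectory Pr ℱ X state action) {g : Ξ → ℝ}
    (hg : Measurable g) {l D : ℝ} (hgI : ∀ᵐ x ∂M.ν, g x ∈ Set.Icc l (l + D)) (n : ℕ) :
    HasSubgaussianMGF (fun ω => ∑ i ∈ Finset.range n, (g (X i ω) - ∫ x, g x ∂M.ν))
      (n * (‖D‖₊ / 2) ^ 2) Pr := by
  induction n with
  | zero => simp
  | succ n ih =>
    have h1 : HasSubgaussianMGF (fun ω => g (X n ω) - ∫ x, g x ∂M.ν) ((‖D‖₊ / 2) ^ 2) Pr := by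
      have := hasSubgaussianMGF_of_mem_Icc (μ := Pr) (X := fun ω => g (X n ω))
        (hg.comp (ht.measurable_X n)).aemeasurable (ht.ae_X hgI n)
      rwa [ht.integral_comp_X hg, add_sub_cancel_left] at this
    have hg' : Measurable fun x => g x - ∫ x, g x ∂M.ν := hg.sub_const _
    have hind : IndepFun (fun ω => ∑ i ∈ Finset.range n, (g (X i ω) - ∫ x, g x ∂M.ν))
        (fun ω => g (X n ω) - ∫ x, g x ∂M.ν) Pr := by
      rw [IndepFun_iff_Indep]
      refine indep_of_indep_of_le_left (indep_of_indep_of_le_right (ht.X_indep n).symm ?_) ?_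
      · exact (hg'.comp (comap_measurable (X n))).comap_le
      · exact (ht.measurable_sum hg' n).comap_le
    have := ih.add_of_indepFun h1 hind
    simp only [Finset.sum_range_succ]
    convert this using 1
    push_cast
    ring

/-- Hoeffding's inequality for the samples of the internal variable. -/
theorem measureReal_sum_ge_le (ht : M.IsTrajectory Pr ℱ X state action) {g : Ξ → ℝ}
    (hg : Measurable g) {l D : ℝ} (hD : 0 < D) (hgI : ∀ᵐ x ∂M.ν, g x ∈ Set.Icc l (l + D))
    {n : ℕ} (hn : 1 ≤ n) {δ : ℝ} (hδ : 0 ≤ δ) :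
    Pr.real {ω | n * (∫ x, g x ∂M.ν + δ) ≤ ∑ i ∈ Finset.range n, g (X i ω)} ≤
      Real.exp (-2 * (δ / D) ^ 2 * n) := by
  have h := (ht.hasSubgaussianMGF_sum hg hgI n).measure_ge_le (ε := n * δ) (by positivity)
  have hn' : (0 : ℝ) < n := by exact_mod_cast hn
  convert h using 2
  · ext ω
    simp only [Set.mem_ofPred_eq, Finset.sum_sub_distrib, Finset.sum_const, Finset.card_range,
      nsmul_eq_mul, mul_add]
    constructor <;> intro h <;> linarith
  · push_cast
    rw [Real.norm_eq_abs, abs_of_pos hD]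
    field_simp

end IsTrajectory

variable [IsProbabilityMeasure Pr]

/-- The policy computed from the estimates of slot `n` is suboptimal with exponentially small
probability. -/
theorem measureReal_policy_ne_le [Nonempty S] [DecidableEq S]
    (ht : M.IsTrajectory Pr ℱ X state action) (hM : M.IsErgodic)
    {βstar : M.Policy}
    (hopt : ∀ β : M.Policy, β ≠ βstar → M.rho β M.meanReward < M.rho βstar M.meanReward)
    (hne : ∃ β : M.Policy, β ≠ βstar)
    {supp : Set Ξ} (hsupp : ∀ᵐ x ∂M.ν, x ∈ supp) {B : S → A → ℝ}
    (hB : ∀ s, ∀ a ∈ M.allowed s, ∀ x ∈ supp, ∀ y ∈ supp, M.f s a x - M.f s a y ≤ B s a)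
    (hB₀ : 0 < M.maxRange B) {n : ℕ} (hn : 1 ≤ n) {policy : Ω → M.Policy}
    (hpol : ∀ ω, M.IsLPPolicy (M.theta (fun i => X i ω) n) (policy ω)) :
    Pr.real {ω | policy ω ≠ βstar} ≤ (1 + Fintype.card A) * Fintype.card S *
      Real.exp (-(1 / 2) * (M.delta1 βstar / M.maxRange B) ^ 2 * n) := by
  classical
  -- Half of the gap for each of two deviations: `βstar` underestimated, or the chosen policy
  -- overestimated.
  set δ := M.delta1 βstar / 2 with hδ
  set E := Real.exp (-(1 / 2) * (M.delta1 βstar / M.maxRange B) ^ 2 * n) with hE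
  have hδ0 : 0 ≤ δ := by have := delta1_pos hopt hne; positivity
  have hEδ : Real.exp (-2 * (δ / M.maxRange B) ^ 2 * n) = E := by
    rw [hE, hδ]
    congr 1
    ring
  have hn' : (0 : ℝ) < n := by exact_mod_cast hn
  -- The chosen policy is random, so overestimation is excluded at all valid pairs; underestimation
  -- matters only at the pairs of `βstar`. This gives at most S A + S events.
  let U : M.Pair → Set Ω := fun p =>
    {ω | M.meanReward p.1.1 p.1.2 + δ ≤ M.theta (fun i => X i ω) n p.1.1 p.1.2}
  let L : S → Set Ω := fun s =>
    {ω | M.theta (fun i => X i ω) n s (βstar s) + δ ≤ M.meanReward s (βstar s)}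
  have hU : ∀ p, Pr.real (U p) ≤ E := by
    rintro ⟨⟨s, a⟩, ha⟩
    obtain ⟨l, hl⟩ := exists_ae_mem_Icc hsupp hB ha
    rw [← hEδ]
    convert ht.measureReal_sum_ge_le (M.f_measurable s a ha) hB₀ hl hn hδ0 using 2
    ext ω
    simp only [U, Set.mem_ofPred_eq, ← nat_mul_theta, mul_le_mul_iff_right₀ hn', meanReward]
  have hL : ∀ s, Pr.real (L s) ≤ E := by
    intro s
    obtain ⟨l, hl⟩ := exists_ae_mem_Icc hsupp hB (βstar s).2
    rw [← hEδ]
    have hl' : ∀ᵐ x ∂M.ν, -M.f s (βstar s) x ∈ Set.Icc (-(l + M.maxRange B))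
        (-(l + M.maxRange B) + M.maxRange B) := by
      filter_upwards [hl] with x hx
      exact ⟨by linarith [hx.2], by linarith [hx.1]⟩
    convert ht.measureReal_sum_ge_le (M.f_measurable s _ (βstar s).2).neg hB₀ hl' hn hδ0 using 2
    ext ω
    simp only [L, Set.mem_ofPred_eq, Pi.neg_apply, Finset.sum_neg_distrib, ← nat_mul_theta,
      integral_neg, meanReward, ← mul_neg, mul_le_mul_iff_right₀ hn']
    constructor <;> intro h <;> linarith
  have hsub : {ω | policy ω ≠ βstar} ⊆ (⋃ s, L s) ∪ ⋃ p, U p := by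
    intro ω hω
    by_contra hcon
    simp only [Set.mem_union, Set.mem_iUnion, not_or, not_exists, L, U, Set.mem_ofPred_eq,
      not_le] at hcon
    have h1 := M.rho_le_rho_add βstar (R := M.meanReward)
      (R' := M.theta (fun i => X i ω) n) hcon.1
    have h2 := M.rho_le_rho_add (policy ω) (R := M.theta (fun i => X i ω) n)
      (R' := M.meanReward) fun s => hcon.2 ⟨(s, policy ω s), (policy ω s).2⟩
    have h3 := (hpol ω).rho_le hM βstar
    have h4 := delta1_le (M := M) (show policy ω ≠ βstar from hω)
    rw [rhoStar_eq hopt] at h4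
    linarith
  have hcard : (Fintype.card M.Pair : ℝ) ≤ Fintype.card S * Fintype.card A := by
    rw [← Nat.cast_mul, ← Fintype.card_prod]
    exact_mod_cast Fintype.card_subtype_le _
  have hE0 : 0 ≤ E := (Real.exp_pos _).le
  calc Pr.real {ω | policy ω ≠ βstar}
      ≤ Pr.real ((⋃ s, L s) ∪ ⋃ p, U p) := measureReal_mono hsub
    _ ≤ Pr.real (⋃ s, L s) + Pr.real (⋃ p, U p) := measureReal_union_le _ _
    _ ≤ ∑ s, Pr.real (L s) + ∑ p, Pr.real (U p) :=
        add_le_add (measureReal_iUnion_fintype_le _) (measureReal_iUnion_fintype_le _)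
    _ ≤ ∑ _s : S, E + ∑ _p : M.Pair, E :=
        add_le_add (Finset.sum_le_sum fun s _ => hL s) (Finset.sum_le_sum fun p _ => hU p)
    _ = Fintype.card S * E + Fintype.card M.Pair * E := by simp
    _ ≤ Fintype.card S * E + Fintype.card S * Fintype.card A * E := by gcongr
    _ = _ := by ring

end RewardMDP

/-! ### From trajectories to the regret decomposition. -/

theorem measurable_comp_of_finite {Ω F : Type*} [Finite F] {m : MeasurableSpace Ω} {φ : Ω → F}
    (h : ∀ x, MeasurableSet (φ ⁻¹' {x})) (g : F → ℝ) : Measurable fun ω => g (φ ω) := by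
  let : MeasurableSpace F := ⊤
  exact measurable_from_top.comp (measurable_to_countable' h)

theorem integrable_comp_of_finite {Ω F : Type*} [Finite F] {m : MeasurableSpace Ω}
    {μ : Measure Ω} [IsFiniteMeasure μ] {φ : Ω → F} (h : ∀ x, MeasurableSet (φ ⁻¹' {x}))
    (g : F → ℝ) : Integrable (fun ω => g (φ ω)) μ := by
  obtain ⟨C, hC⟩ := (Set.finite_range fun x => ‖g x‖).bddAbove
  exact Integrable.of_bound (measurable_comp_of_finite h g).aestronglyMeasurable C
    (ae_of_all _ fun ω => hC ⟨φ ω, rfl⟩)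

open Classical in
/-- The increments of a sequence in `[0, H]` over the times in a set `G` add up to at most `H` for
each time at which `G` is entered. -/
theorem sum_increments_le {G : ℕ → Prop} (hG : ¬ G 0) {h : ℕ → ℝ} {H : ℝ}
    (h0 : ∀ n, 0 ≤ h n) (hH : ∀ n, h n ≤ H) (T : ℕ) :
    ∑ t ∈ Finset.range T, (if G t then h (t + 1) - h t else 0) ≤
      H * ∑ t ∈ Finset.range T, (if G (t + 1) ∧ ¬ G t then 1 else 0) := by
  -- Strengthened for the induction: each entry pays `H`, and inside a run the unspent credit is `H
  -- - h T`.
  have key : ∑ t ∈ Finset.range T, (if G t then h (t + 1) - h t else 0) +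
      (if G T then H - h T else 0) ≤
      H * ∑ t ∈ Finset.range T, (if G (t + 1) ∧ ¬ G t then 1 else 0) := by
    induction T with
    | zero => simp [hG]
    | succ T ih =>
      rw [Finset.sum_range_succ, Finset.sum_range_succ, mul_add]
      have h1 := h0 T
      have h2 := hH (T + 1)
      have h3 := h0 (T + 1)
      by_cases hT : G T <;> by_cases hT' : G (T + 1) <;> simp [hT, hT'] at ih ⊢ <;> linarith
  refine le_trans (le_add_of_nonneg_right ?_) key
  split_ifs
  · linarith [hH T]
  · exact le_rfl

namespace RewardMDP

variable {S A Ξ : Type*} [Fintype S] [Fintype A] [MeasurableSpace Ξ] {M : RewardMDP S A Ξ}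
  {Ω : Type*} [mΩ : MeasurableSpace Ω] {Pr : Measure Ω}
  {ℱ : Filtration ℕ mΩ} {X : ℕ → Ω → Ξ} {state : ℕ → Ω → S} {action : ℕ → Ω → A}

namespace IsTrajectory

theorem measurableSet_pair (ht : M.IsTrajectory Pr ℱ X state action) (t : ℕ) (x : S × A) :
    MeasurableSet[ℱ t] ((fun ω => (state t ω, action t ω)) ⁻¹' {x}) := by
  have : (fun ω => (state t ω, action t ω)) ⁻¹' {x} =
      state t ⁻¹' {x.1} ∩ action t ⁻¹' {x.2} := by
    ext ω
    simp [Prod.ext_iff]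
  rw [this]
  exact (ht.state_adapted t x.1).inter (ht.action_adapted t x.2)

theorem measurable_pair (ht : M.IsTrajectory Pr ℱ X state action) (t : ℕ) (g : S → A → ℝ) :
    Measurable[ℱ t] fun ω => g (state t ω) (action t ω) :=
  measurable_comp_of_finite (m := ℱ t) (ht.measurableSet_pair t) fun x : S × A => g x.1 x.2

variable [IsProbabilityMeasure Pr]

theorem integrable_pair (ht : M.IsTrajectory Pr ℱ X state action) (t : ℕ) (g : S → A → ℝ) :
    Integrable (fun ω => g (state t ω) (action t ω)) Pr :=
  integrable_comp_of_finite (fun x => ℱ.le t _ (ht.measurableSet_pair t x))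
    fun x : S × A => g x.1 x.2

theorem integrable_state (ht : M.IsTrajectory Pr ℱ X state action) (t : ℕ) (g : S → ℝ) :
    Integrable (fun ω => g (state t ω)) Pr :=
  ht.integrable_pair t fun s _ => g s

/-- The expected reward of a slot is the expectation of the mean reward of its state-action
pair. -/
theorem integral_reward (ht : M.IsTrajectory Pr ℱ X state action)
    (hf : ∀ s, ∀ a ∈ M.allowed s, Integrable (M.f s a) M.ν) (t : ℕ) :
    Integrable (fun ω => M.f (state t ω) (action t ω) (X t ω)) Pr ∧
    ∫ ω, M.f (state t ω) (action t ω) (X t ω) ∂Pr =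
      ∫ ω, M.meanReward (state t ω) (action t ω) ∂Pr := by
  classical
  -- Expanding over the finitely many pairs writes the reward as a sum of products of an indicator
  -- of the past and an independent function of `X t`.
  let g : M.Pair → S → A → ℝ := fun p s a => if p.1 = (s, a) then 1 else 0
  have hdecomp : ∀ F : S → A → ℝ, ∀ ω, F (state t ω) (action t ω) =
      ∑ p : M.Pair, g p (state t ω) (action t ω) * F p.1.1 p.1.2 := by
    intro F ω
    rw [Finset.sum_eq_single_of_mem
      (⟨(state t ω, action t ω), ht.action_allowed t ω⟩ : M.Pair) (Finset.mem_univ _)]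
    · simp [g]
    · rintro p - hp
      have : p.1 ≠ (state t ω, action t ω) := fun h => hp (Subtype.ext h)
      simp [g, this]
  have hfX : ∀ p : M.Pair, Integrable (fun ω => M.f p.1.1 p.1.2 (X t ω)) Pr := by
    intro p
    have h := hf _ _ p.2
    rw [← ht.X_law t] at h
    exact h.comp_measurable (ht.measurable_X t)
  have hind : ∀ p : M.Pair, IndepFun (fun ω => g p (state t ω) (action t ω))
      (fun ω => M.f p.1.1 p.1.2 (X t ω)) Pr := by
    intro p
    rw [IndepFun_iff_Indep]
    refine indep_of_indep_of_le_left (indep_of_indep_of_le_right (ht.X_indep t).symm ?_) ?_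
    · exact ((M.f_measurable _ _ p.2).comp (comap_measurable (X t))).comap_le
    · exact (ht.measurable_pair t (g p)).comap_le
  have hint : ∀ p : M.Pair, Integrable
      (fun ω => g p (state t ω) (action t ω) * M.f p.1.1 p.1.2 (X t ω)) Pr := fun p =>
    (hind p).integrable_mul (ht.integrable_pair t (g p)) (hfX p)
  have heq : (fun ω => M.f (state t ω) (action t ω) (X t ω)) = fun ω =>
      ∑ p : M.Pair, g p (state t ω) (action t ω) * M.f p.1.1 p.1.2 (X t ω) := by
    ext ω
    exact hdecomp (fun s a => M.f s a (X t ω)) ω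
  rw [heq]
  refine ⟨integrable_finsetSum _ fun p _ => hint p, ?_⟩
  rw [integral_finsetSum _ fun p _ => hint p]
  simp_rw [hdecomp M.meanReward]
  rw [integral_finsetSum _ fun p _ => (ht.integrable_pair t (g p)).mul_const _]
  refine Finset.sum_congr rfl fun p _ => ?_
  rw [(hind p).integral_fun_mul_eq_mul_integral (ht.integrable_pair t (g p)).1 (hfX p).1,
    integral_mul_const, ht.integral_comp_X (M.f_measurable _ _ p.2)]
  rfl

/-- One-step expectation of a function of the state, restricted to an event of the past. -/
theorem setIntegral_next_state (ht : M.IsTrajectory Pr ℱ X state action) (h : S → ℝ) {t : ℕ}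
    {G : Set Ω} (hG : MeasurableSet[ℱ t] G) :
    ∫ ω in G, h (state (t + 1) ω) ∂Pr =
      ∫ ω in G, ∑ s', M.P (state t ω) (action t ω) s' * h s' ∂Pr := by
  classical
  have hmeas : ∀ s', MeasurableSet (state (t + 1) ⁻¹' {s'}) := fun s' =>
    ℱ.le _ _ (ht.state_adapted (t + 1) s')
  have hone : ∀ s', Integrable ((state (t + 1) ⁻¹' {s'}).indicator fun _ => (1 : ℝ)) Pr :=
    fun s' => (integrable_const _).indicator (hmeas s')
  have hdecomp : ∀ ω, h (state (t + 1) ω) =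
      ∑ s', (state (t + 1) ⁻¹' {s'}).indicator (fun _ => (1 : ℝ)) ω * h s' := by
    intro ω
    simp [Set.indicator_apply, ite_mul]
  simp_rw [hdecomp]
  rw [integral_finsetSum _ fun s' _ => ((hone s').mul_const _).integrableOn,
    integral_finsetSum _ fun s' _ =>
      ((ht.integrable_pair t fun s a => M.P s a s').mul_const _).integrableOn]
  refine Finset.sum_congr rfl fun s' _ => ?_
  rw [integral_mul_const, integral_mul_const, ← setIntegral_condExp (ℱ.le t) (hone s') hG]
  congr 1
  exact integral_congr_ae (ae_restrict_of_ae (ht.transition t s'))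

end IsTrajectory

/-- Regret bound in terms of the slots in which the optimal action is guaranteed (`G t`): every
other slot costs at most `Δ_max`, and every entry into `G` costs at most the oscillation of the
solution of the Poisson equation. -/
theorem regret_le_of_good [Nonempty S] [IsProbabilityMeasure Pr]
    (ht : M.IsTrajectory Pr ℱ X state action)
    (hf : ∀ s, ∀ a ∈ M.allowed s, Integrable (M.f s a) M.ν)
    {βstar : M.Policy} (hstar : M.rhoStar = M.rho βstar M.meanReward)
    (hμ : ∀ s, ∀ a ∈ M.allowed s, 0 ≤ M.meanReward s a) (hγ : M.gammaTV βstar < 1)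
    {G : ℕ → Set Ω} (hGm : ∀ t, MeasurableSet[ℱ t] (G t)) (hG0 : G 0 = ∅)
    (hGa : ∀ t, ∀ ω ∈ G t, action t ω = βstar (state t ω)) (T : ℕ) :
    M.regret Pr X state action T ≤
      (∑ t ∈ Finset.range T, Pr.real (G t)ᶜ) * M.deltaMax +
      (∑ t ∈ Finset.range T, Pr.real (G (t + 1) \ G t)) *
        (M.muMax / (1 - M.gammaTV βstar)) := by
  classical
  obtain ⟨h, h0, hH, hpois⟩ := exists_poisson (Q := M.transMatrix βstar)
    (fun s => M.P_sum s _ (βstar s).2) (M.isStationaryDist_stationaryDist βstar) hγ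
    (M.tvDist_le_gammaTV βstar) (r := fun s => M.meanReward s (βstar s)) (D := M.muMax)
    (fun s => hμ s _ (βstar s).2) (fun s => meanReward_le_muMax (βstar s).2)
  set H := M.muMax / (1 - M.gammaTV βstar)
  have hGm' : ∀ t, MeasurableSet (G t) := fun t => ℱ.le t _ (hGm t)
  have hreg : M.regret Pr X state action T =
      ∑ t ∈ Finset.range T, ∫ ω, (M.rhoStar - M.meanReward (state t ω) (action t ω)) ∂Pr := by
    rw [regret, integral_finsetSum _ fun t _ => (ht.integral_reward hf t).1]
    simp_rw [fun t => (ht.integral_reward hf t).2,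
      fun t => integral_sub (integrable_const M.rhoStar) (ht.integrable_pair t M.meanReward)]
    simp
  have hdint : ∀ t, Integrable (fun ω => h (state (t + 1) ω) - h (state t ω)) Pr := fun t =>
    (ht.integrable_state (t + 1) h).sub (ht.integrable_state t h)
  -- Since `G t` belongs to the past, the one-step expectation can be taken on it, and the Poisson
  -- equation makes the loss there equal to the expected increment of `h`.
  have hslot : ∀ t, ∫ ω, (M.rhoStar - M.meanReward (state t ω) (action t ω)) ∂Pr ≤
      Pr.real (G t)ᶜ * M.deltaMax +
        ∫ ω, (if ω ∈ G t then h (state (t + 1) ω) - h (state t ω) else 0) ∂Pr := by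
    intro t
    have hli : Integrable (fun ω => M.rhoStar - M.meanReward (state t ω) (action t ω)) Pr :=
      (integrable_const _).sub (ht.integrable_pair t M.meanReward)
    rw [← integral_add_compl (hGm' t) hli, add_comm]
    refine add_le_add ?_ (le_of_eq ?_)
    · calc ∫ ω in (G t)ᶜ, (M.rhoStar - M.meanReward (state t ω) (action t ω)) ∂Pr
          ≤ ∫ _ω in (G t)ᶜ, M.deltaMax ∂Pr :=
            setIntegral_mono_on hli.integrableOn (integrable_const _).integrableOn
              (hGm' t).compl fun ω _ => rhoStar_sub_le_deltaMax (ht.action_allowed t ω)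
        _ = Pr.real (G t)ᶜ * M.deltaMax := by simp
    · have hind : ∫ ω, (if ω ∈ G t then h (state (t + 1) ω) - h (state t ω) else 0) ∂Pr =
          ∫ ω in G t, (h (state (t + 1) ω) - h (state t ω)) ∂Pr :=
        integral_indicator (hGm' t)
      rw [hind, integral_sub (ht.integrable_state _ h).integrableOn
        (ht.integrable_state _ h).integrableOn, ht.setIntegral_next_state h (hGm t),
        ← integral_sub (ht.integrable_pair t fun s a => ∑ s', M.P s a s' * h s').integrableOn
          (ht.integrable_state _ h).integrableOn]
      refine setIntegral_congr_fun (hGm' t) fun ω hω => ?_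
      have hp : h (state t ω) -
          ∑ s', M.P (state t ω) (βstar (state t ω)) s' * h s' =
          M.meanReward (state t ω) (βstar (state t ω)) - M.rho βstar M.meanReward :=
        hpois (state t ω)
      simp only [hGa t ω hω, hstar]
      linarith
  have hpath : ∑ t ∈ Finset.range T,
      ∫ ω, (if ω ∈ G t then h (state (t + 1) ω) - h (state t ω) else 0) ∂Pr ≤
      (∑ t ∈ Finset.range T, Pr.real (G (t + 1) \ G t)) * H := by
    have hI : ∀ t, (fun ω => if ω ∈ G (t + 1) ∧ ω ∉ G t then (1 : ℝ) else 0) =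
        (G (t + 1) \ G t).indicator 1 := by
      intro t
      ext ω
      simp [Set.indicator_apply]
    have hone : ∀ t, Integrable (fun ω => if ω ∈ G (t + 1) ∧ ω ∉ G t then (1 : ℝ) else 0) Pr := by
      intro t
      rw [hI]
      exact (integrable_const (1 : ℝ)).indicator ((hGm' (t + 1)).diff (hGm' t))
    have hone' : ∀ t, ∫ ω, (if ω ∈ G (t + 1) ∧ ω ∉ G t then (1 : ℝ) else 0) ∂Pr =
        Pr.real (G (t + 1) \ G t) := by
      intro t
      rw [hI]
      exact integral_indicator_one ((hGm' (t + 1)).diff (hGm' t))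
    have hinc : ∀ t, Integrable
        (fun ω => if ω ∈ G t then h (state (t + 1) ω) - h (state t ω) else 0) Pr :=
      fun t => (hdint t).indicator (hGm' t)
    rw [← integral_finsetSum _ fun t _ => hinc t, mul_comm]
    simp_rw [← hone']
    rw [← integral_finsetSum _ fun t _ => hone t, ← integral_const_mul]
    refine integral_mono (integrable_finsetSum _ fun t _ => hinc t)
      ((integrable_finsetSum _ fun t _ => hone t).const_mul _) fun ω => ?_
    exact sum_increments_le (G := fun t => ω ∈ G t) (by simp [hG0])
      (h := fun t => h (state t ω)) (fun _ => h0 _) (fun _ => hH _) T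
  calc M.regret Pr X state action T
      ≤ ∑ t ∈ Finset.range T, (Pr.real (G t)ᶜ * M.deltaMax +
        ∫ ω, (if ω ∈ G t then h (state (t + 1) ω) - h (state t ω) else 0) ∂Pr) := by
        rw [hreg]
        exact Finset.sum_le_sum fun t _ => hslot t
    _ ≤ _ := by
        rw [Finset.sum_add_distrib, ← Finset.sum_mul]
        exact add_le_add le_rfl hpath

end RewardMDP

/-! ### Series estimates, epochs, and the final bound. -/

/-- From exp x ≥ x² / 2 with x = a η^k, the terms are at most (2 / a²) η^(-k). -/
theorem summable_pow_mul_exp_neg {η : ℕ} (hη : 2 ≤ η) {a : ℝ} (ha : 0 < a) :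
    Summable fun k : ℕ => (η : ℝ) ^ k * Real.exp (-a * (η : ℝ) ^ k) := by
  have hη' : (1 : ℝ) < η := by exact_mod_cast hη
  refine Summable.of_nonneg_of_le (fun k => by positivity) (fun k => ?_)
    ((summable_geometric_of_lt_one (by positivity) (inv_lt_one_of_one_lt₀ hη')).mul_left
      (2 / a ^ 2))
  have hx : 0 < (η : ℝ) ^ k := by positivity
  have h := Real.pow_div_factorial_le_exp (a * (η : ℝ) ^ k) (by positivity) 2
  rw [neg_mul, Real.exp_neg, inv_pow, ← div_eq_mul_inv, div_le_iff₀ (Real.exp_pos _)]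
  calc (η : ℝ) ^ k = 2 / a ^ 2 * ((η : ℝ) ^ k)⁻¹ * ((a * (η : ℝ) ^ k) ^ 2 / (Nat.factorial 2 : ℕ)) := by
        simp only [Nat.factorial_two]
        push_cast
        field_simp
    _ ≤ _ := mul_le_mul_of_nonneg_left h (by positivity)

theorem sum_exp_neg_mul_succ {c : ℝ} (hc : 0 < c) (n : ℕ) :
    ∑ i ∈ Finset.range n, Real.exp (-c * ((i + 1 : ℕ) : ℝ)) =
      (1 - Real.exp (-c * n)) / (Real.exp c - 1) := by
  have h1 : 0 < Real.exp c - 1 := by linarith [Real.add_one_lt_exp hc.ne']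
  induction n with
  | zero => simp
  | succ n ih =>
    have h2 : Real.exp (-c * n) = Real.exp (-c * ((n + 1 : ℕ) : ℝ)) * Real.exp c := by
      rw [← Real.exp_add]
      push_cast
      congr 1
      ring
    rw [Finset.sum_range_succ, ih, h2]
    field_simp
    ring

/-- Partial sums of a nonnegative sequence, estimated over the blocks `[n₀ η ^ k, n₀ η ^ (k + 1))`. -/
theorem sum_range_le_add_tsum {n₀ η : ℕ} (hn₀ : 1 ≤ n₀) (hη : 2 ≤ η) {v w : ℕ → ℝ} {c : ℝ}
    (hv : ∀ t, 0 ≤ v t) (hw : ∀ k, 0 ≤ w k) (hws : Summable w)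
    (h0 : ∑ t ∈ Finset.range n₀, v t ≤ c)
    (hk : ∀ k, ∑ t ∈ Finset.Ico (n₀ * η ^ k) (n₀ * η ^ (k + 1)), v t ≤ w k) (T : ℕ) :
    ∑ t ∈ Finset.range T, v t ≤ c + ∑' k, w k := by
  have key : ∀ K, ∑ t ∈ Finset.range (n₀ * η ^ K), v t ≤ c + ∑ k ∈ Finset.range K, w k := by
    intro K
    induction K with
    | zero => simpa using h0
    | succ K ih =>
      have hle : n₀ * η ^ K ≤ n₀ * η ^ (K + 1) :=
        Nat.mul_le_mul_left _ (Nat.pow_le_pow_right (by lia) (by lia))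
      rw [← Finset.sum_range_add_sum_Ico _ hle, Finset.sum_range_succ]
      linarith [hk K]
  have hT : T ≤ n₀ * η ^ T := by
    have := (Nat.lt_pow_self (show 1 < η by lia) : T < η ^ T)
    nlinarith
  calc ∑ t ∈ Finset.range T, v t ≤ ∑ t ∈ Finset.range (n₀ * η ^ T), v t :=
        Finset.sum_le_sum_of_subset_of_nonneg (Finset.range_mono hT) fun t _ _ => hv t
    _ ≤ c + ∑ k ∈ Finset.range T, w k := key T
    _ ≤ _ := by
        have := hws.sum_le_tsum (Finset.range T) fun k _ => hw k
        linarith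

namespace RewardMDP

theorem not_isSolveTime {n₀ η n k : ℕ} (hη : 2 ≤ η) (h1 : n₀ * η ^ k < n)
    (h2 : n < n₀ * η ^ (k + 1)) : ¬ IsSolveTime n₀ η n := by
  rintro (⟨_, h⟩ | ⟨j, rfl⟩)
  · have : n₀ * 1 ≤ n₀ * η ^ k := Nat.mul_le_mul_left _ (Nat.one_le_pow _ _ (by lia))
    lia
  · have h3 := (Nat.pow_lt_pow_iff_right (show 1 < η by lia)).mp (Nat.lt_of_mul_lt_mul_left h1)
    have h4 := (Nat.pow_lt_pow_iff_right (show 1 < η by lia)).mp (Nat.lt_of_mul_lt_mul_left h2)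
    lia

variable {S A Ξ : Type*} [Fintype S] [Fintype A] [MeasurableSpace Ξ] {M : RewardMDP S A Ξ}
  {Ω : Type*} [mΩ : MeasurableSpace Ω] {Pr : Measure Ω}
  {ℱ : Filtration ℕ mΩ} {X : ℕ → Ω → Ξ} {state : ℕ → Ω → S} {action : ℕ → Ω → A}
  {policy : ℕ → Ω → M.Policy} {n₀ η : ℕ}

theorem FollowsEpochLPSM.policy_eq (h : M.FollowsEpochLPSM n₀ η ℱ X state action policy)
    (hn₀ : 1 ≤ n₀) (hη : 2 ≤ η) {k t : ℕ} (h1 : n₀ * η ^ k ≤ t) (h2 : t < n₀ * η ^ (k + 1))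
    (ω : Ω) : policy t ω = policy (n₀ * η ^ k) ω := by
  induction t, h1 using Nat.le_induction with
  | base => rfl
  | succ t ht ih =>
    have hpos : 1 ≤ n₀ * η ^ k := Nat.mul_pos hn₀ (Nat.pow_pos (by lia))
    rw [h.keep t ω (by lia) (not_isSolveTime hη (Nat.lt_succ_of_le ht) h2), ih (by lia)]

/-- The event that the policy of slot `t ≥ 1` is `βstar`. -/
def policyEvent (policy : ℕ → Ω → M.Policy) (βstar : M.Policy) (t : ℕ) : Set Ω :=
  {ω | t ≠ 0 ∧ policy t ω = βstar}

variable [IsProbabilityMeasure Pr]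

/-- Expected number of slots in which the policy is not the optimal one, and expected number of
switches to the optimal policy. -/
theorem sum_measureReal_policyEvent_le (h : M.FollowsEpochLPSM n₀ η ℱ X state action policy)
    (hn₀ : 1 ≤ n₀) (hη : 2 ≤ η) {βstar : M.Policy} {C c : ℝ} (hC : 0 ≤ C) (hc : 0 < c)
    (hsolve : ∀ n, 1 ≤ n → IsSolveTime n₀ η n →
      Pr.real {ω | policy n ω ≠ βstar} ≤ C * Real.exp (-c * n)) (T : ℕ) :
    ∑ t ∈ Finset.range T, Pr.real (policyEvent policy βstar t)ᶜ ≤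
      1 + C * ((1 - Real.exp (-c * n₀)) / (Real.exp c - 1)) +
        ∑' k : ℕ, (η - 1) * n₀ * C * ((η : ℝ) ^ k * Real.exp (-(c * n₀) * (η : ℝ) ^ k)) ∧
    ∑ t ∈ Finset.range T,
        Pr.real (policyEvent policy βstar (t + 1) \ policyEvent policy βstar t) ≤
      1 + C * ((1 - Real.exp (-c * n₀)) / (Real.exp c - 1)) +
        ∑' k : ℕ, C * Real.exp (-(c * n₀) * (η : ℝ) ^ k) := by
  set G := policyEvent policy βstar with hG
  have hn₀' : (1 : ℝ) ≤ n₀ := by exact_mod_cast hn₀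
  have hη' : (2 : ℝ) ≤ η := by exact_mod_cast hη
  have hs := summable_pow_mul_exp_neg hη (show 0 < c * n₀ by positivity)
  have hs' : Summable fun k : ℕ => Real.exp (-(c * n₀) * (η : ℝ) ^ k) :=
    Summable.of_nonneg_of_le (fun k => by positivity)
      (fun k => le_mul_of_one_le_left (by positivity) (one_le_pow₀ (by linarith))) hs
  have hb : ∀ n, 1 ≤ n → IsSolveTime n₀ η n → Pr.real (G n)ᶜ ≤ C * Real.exp (-c * n) := by
    intro n hn hsn
    refine le_trans (measureReal_mono fun ω hω => ?_) (hsolve n hn hsn)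
    exact fun heq => hω ⟨by lia, heq⟩
  have hu : ∀ t, Pr.real (G (t + 1) \ G t) ≤ Pr.real (G t)ᶜ := fun t =>
    measureReal_mono fun ω hω => hω.2
  have hpos : ∀ k, 1 ≤ n₀ * η ^ k := fun k => Nat.mul_pos hn₀ (Nat.pow_pos (by lia))
  have hGeq : ∀ k t, n₀ * η ^ k ≤ t → t < n₀ * η ^ (k + 1) → G t = G (n₀ * η ^ k) := by
    intro k t h1 h2
    ext ω
    have := hpos k
    change (t ≠ 0 ∧ policy t ω = βstar) ↔ (n₀ * η ^ k ≠ 0 ∧ policy (n₀ * η ^ k) ω = βstar)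
    rw [h.policy_eq hn₀ hη h1 h2, and_congr_left_iff]
    intro
    constructor <;> intro <;> lia
  have hbk : ∀ k t, n₀ * η ^ k ≤ t → t < n₀ * η ^ (k + 1) →
      Pr.real (G t)ᶜ ≤ C * Real.exp (-(c * n₀) * (η : ℝ) ^ k) := by
    intro k t h1 h2
    rw [hGeq k t h1 h2]
    refine (hb _ (hpos k) (Or.inr ⟨k, rfl⟩)).trans_eq ?_
    push_cast
    congr 2
    ring
  -- Slot 0 counts 1, and every slot from 1 to `n₀ - 1` is a solve time. The closed form sums `n₀`
  -- exponentials, one more than needed.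
  have hinit : ∀ v : ℕ → ℝ, (∀ t, v t ≤ Pr.real (G t)ᶜ) → ∑ t ∈ Finset.range n₀, v t ≤
      1 + C * ((1 - Real.exp (-c * n₀)) / (Real.exp c - 1)) := by
    intro v hv
    rw [← sum_exp_neg_mul_succ hc]
    obtain ⟨m, rfl⟩ : ∃ m, n₀ = m + 1 := ⟨n₀ - 1, by lia⟩
    rw [Finset.sum_range_succ', add_comm]
    refine add_le_add ((hv 0).trans measureReal_le_one) ?_
    calc ∑ t ∈ Finset.range m, v (t + 1)
        ≤ ∑ t ∈ Finset.range m, C * Real.exp (-c * ((t + 1 : ℕ) : ℝ)) := by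
          refine Finset.sum_le_sum fun t ht => (hv _).trans (hb _ (by lia) (Or.inl ⟨by lia, ?_⟩))
          have := Finset.mem_range.mp ht
          lia
      _ = C * ∑ t ∈ Finset.range m, Real.exp (-c * ((t + 1 : ℕ) : ℝ)) := by
          rw [Finset.mul_sum]
      _ ≤ _ := by
          refine mul_le_mul_of_nonneg_left ?_ hC
          exact Finset.sum_le_sum_of_subset_of_nonneg (Finset.range_mono (by lia))
            fun _ _ _ => (Real.exp_pos _).le
  constructor
  · refine sum_range_le_add_tsum hn₀ hη (fun t => measureReal_nonneg) (fun k => ?_)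
      (hs.mul_left _) (hinit _ fun t => le_rfl) (fun k => ?_) T
    · have : 0 ≤ (η : ℝ) - 1 := by linarith
      positivity
    · refine (Finset.sum_le_card_nsmul _ _ _ fun t ht =>
        hbk k t (Finset.mem_Ico.mp ht).1 (Finset.mem_Ico.mp ht).2).trans_eq ?_
      rw [Nat.card_Ico, nsmul_eq_mul, Nat.cast_sub
        (Nat.mul_le_mul_left _ (Nat.pow_le_pow_right (by lia) (by lia)))]
      push_cast
      ring
  · refine sum_range_le_add_tsum hn₀ hη (fun t => measureReal_nonneg) (fun k => by positivity)
      (hs'.mul_left _) (hinit _ hu) (fun k => ?_) T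
    have hlt : n₀ * η ^ k < n₀ * η ^ (k + 1) :=
      Nat.mul_lt_mul_of_pos_left (Nat.pow_lt_pow_right (by lia) (by lia)) hn₀
    -- Within a block the policy does not change, so an entry can occur only on leaving its last
    -- slot.
    rw [Finset.sum_eq_single_of_mem (n₀ * η ^ (k + 1) - 1)
      (Finset.mem_Ico.mpr ⟨by lia, by lia⟩) fun t ht hne => ?_]
    · exact (hu _).trans (hbk k _ (by lia) (by lia))
    · have := Finset.mem_Ico.mp ht
      rw [hGeq k t this.1 this.2, hGeq k (t + 1) (by lia) (by lia)]
      simp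

end RewardMDP

/-- The second series is indexed from k = 0, with η^k in place of η^(k-1). Its exponent agrees with
that of the first, as 2 (Δ₁ / (2 B₀))² = (Δ₁ / B₀)² / 2. -/
theorem mainTheorem2 {S A Ξ Ω : Type*} [Fintype S] [DecidableEq S] [Fintype A]
    [MeasurableSpace Ξ] [mΩ : MeasurableSpace Ω]
    (M : RewardMDP S A Ξ) (hM : M.IsErgodic)
    -- the unique optimal policy, with at least one competitor
    (βstar : M.Policy)
    (hopt : ∀ β : M.Policy, β ≠ βstar → M.rho β M.meanReward < M.rho βstar M.meanReward)
    (hne : ∃ β : M.Policy, β ≠ βstar)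
    (hμ : ∀ s, ∀ a ∈ M.allowed s, 0 ≤ M.meanReward s a)
    -- bounds `B s a` on the range of the rewards over the support `supp` of `X`
    (supp : Set Ξ) (hsupp : ∀ᵐ x ∂M.ν, x ∈ supp) (B : S → A → ℝ)
    (hB : ∀ s, ∀ a ∈ M.allowed s, ∀ x ∈ supp, ∀ y ∈ supp, M.f s a x - M.f s a y ≤ B s a)
    (B₀ Δ₁ γ μmax Δmax : ℝ)
    (hB₀ : B₀ = M.maxRange B) (hB₀_pos : 0 < B₀)
    (hΔ₁ : Δ₁ = M.delta1 βstar)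
    (hγ : γ = M.gammaTV βstar) (hγ_lt : γ < 1)
    (hμmax : μmax = M.muMax) (hΔmax : Δmax = M.deltaMax)
    (n₀ η : ℕ) (hn₀ : 1 ≤ n₀) (hη : 2 ≤ η)
    (Pr : Measure Ω) [IsProbabilityMeasure Pr] (ℱ : Filtration ℕ mΩ)
    (X : ℕ → Ω → Ξ) (state : ℕ → Ω → S) (action : ℕ → Ω → A) (policy : ℕ → Ω → M.Policy)
    (htraj : M.IsTrajectory Pr ℱ X state action)
    (halg : M.FollowsEpochLPSM n₀ η ℱ X state action policy) :
    Summable (fun k : ℕ => (η : ℝ) ^ k * Real.exp (-(1 / 2) * (Δ₁ / B₀) ^ 2 * n₀ * (η : ℝ) ^ k)) ∧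
    Summable (fun k : ℕ => Real.exp (-2 * (Δ₁ / (2 * B₀)) ^ 2 * n₀ * (η : ℝ) ^ k)) ∧
    ∀ T : ℕ, M.regret Pr X state action T ≤
      (1 + (1 + Fintype.card A) * Fintype.card S *
          ((1 - Real.exp (-(1 / 2) * (Δ₁ / B₀) ^ 2 * n₀)) /
            (Real.exp ((1 / 2) * (Δ₁ / B₀) ^ 2) - 1))) * (μmax / (1 - γ) + Δmax)
      + (η - 1) * (1 + Fintype.card A) * Fintype.card S * n₀ *
          (∑' k : ℕ, (η : ℝ) ^ k * Real.exp (-(1 / 2) * (Δ₁ / B₀) ^ 2 * n₀ * (η : ℝ) ^ k)) * Δmax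
      + (1 + Fintype.card A) * Fintype.card S *
          (∑' k : ℕ, Real.exp (-2 * (Δ₁ / (2 * B₀)) ^ 2 * n₀ * (η : ℝ) ^ k)) *
          (μmax / (1 - γ)) := by
  have hΩ : Nonempty Ω := nonempty_of_isProbabilityMeasure Pr
  have hS : Nonempty S := hΩ.map (state 0)
  have hν := M.ν_prob
  subst hB₀ hΔ₁ hγ hμmax hΔmax
  have hΔ := RewardMDP.delta1_pos hopt hne
  have hn₀' : (1 : ℝ) ≤ n₀ := by exact_mod_cast hn₀
  have hη' : (2 : ℝ) ≤ η := by exact_mod_cast hη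
  set d := M.delta1 βstar / M.maxRange B with hd
  set c := 1 / 2 * d ^ 2 with hc_def
  have hc : 0 < c := by positivity
  have e1 : ∀ k : ℕ, Real.exp (-(1 / 2) * d ^ 2 * n₀ * (η : ℝ) ^ k) =
      Real.exp (-(c * n₀) * (η : ℝ) ^ k) := fun k => by
    rw [hc_def]
    congr 1
    ring
  have e2 : ∀ k : ℕ, Real.exp (-2 * (M.delta1 βstar / (2 * M.maxRange B)) ^ 2 * n₀ *
      (η : ℝ) ^ k) = Real.exp (-(c * n₀) * (η : ℝ) ^ k) := fun k => by
    rw [hc_def, hd]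
    congr 1
    field_simp
  simp_rw [e1, e2]
  have hs := summable_pow_mul_exp_neg hη (show 0 < c * n₀ by positivity)
  refine ⟨hs, Summable.of_nonneg_of_le (fun k => by positivity)
      (fun k => le_mul_of_one_le_left (by positivity) (one_le_pow₀ (by linarith))) hs,
      fun T => ?_⟩
  have hf : ∀ s, ∀ a ∈ M.allowed s, Integrable (M.f s a) M.ν := fun s a ha => by
    obtain ⟨l, hl⟩ := RewardMDP.exists_ae_mem_Icc hsupp hB ha
    exact Integrable.of_mem_Icc _ _ (M.f_measurable s a ha).aemeasurable hl
  have hsolve : ∀ n, 1 ≤ n → RewardMDP.IsSolveTime n₀ η n →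
      Pr.real {ω | policy n ω ≠ βstar} ≤
        (1 + Fintype.card A) * Fintype.card S * Real.exp (-c * n) := by
    intro n hn hsn
    have := RewardMDP.measureReal_policy_ne_le htraj hM hopt hne hsupp hB hB₀_pos hn
      fun ω => halg.solve n ω hsn
    rwa [← hd, neg_mul] at this
  obtain ⟨hbad, henter⟩ :=
    RewardMDP.sum_measureReal_policyEvent_le halg hn₀ hη (by positivity) hc hsolve T
  have hreg := RewardMDP.regret_le_of_good htraj hf (RewardMDP.rhoStar_eq hopt) hμ hγ_lt
    (G := RewardMDP.policyEvent policy βstar)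
    (fun t => by
      by_cases ht : t = 0
      · simp [RewardMDP.policyEvent, ht]
      · convert halg.policy_adapted t βstar using 1
        ext ω
        simp [RewardMDP.policyEvent, ht])
    (by simp [RewardMDP.policyEvent])
    (fun t ω hω => by
      rw [halg.act t ω (Nat.one_le_iff_ne_zero.mpr hω.1), hω.2]) T
  have hH : 0 ≤ M.muMax / (1 - M.gammaTV βstar) := by
    obtain ⟨s⟩ := hS
    exact div_nonneg ((hμ s _ (βstar s).2).trans (RewardMDP.meanReward_le_muMax (βstar s).2))
      (by linarith)
  have hD := RewardMDP.deltaMax_nonneg (M := M) βstar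
  rw [tsum_mul_left] at hbad henter
  have h1 := mul_le_mul_of_nonneg_right hbad hD
  have h2 := mul_le_mul_of_nonneg_right henter hH
  have e3 : -(1 / 2) * d ^ 2 * (n₀ : ℝ) = -c * n₀ := by rw [hc_def]; ring
  rw [e3]
  linarith
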